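/- Let $e\ge 2$ and $r\ge 2$ be integers, and let $B^{\oplus}(e,e,r)$ be the monoid generated by $t_i$ ($i\in\mathbb{Z}/e$) and $s_3,\dots,s_r$ subject to the relations $s_is_js_i=s_js_is_j$ for $|i-j|=1$; $s_is_j=s_js_i$ for $|i-j|>1$; $s_3t_is_3=t_is_3t_i$ for $i\in\mathbb{Z}/e$; $s_jt_i=t_is_j$ for $i\in\mathbb{Z}/e$ and $4\le j\le r$; and $t_it_{i-1}=t_jt_{j-1}$ for $i,j\in\mathbb{Z}/e$. Let $\tau=t_it_{i-1}$ (which does not depend on $i$), let $\Lambda_2=\tau$ and $\Lambda_k=s_k\cdots s_3\,\tau\,s_3\cdots s_k$ for $3\le k\le r$, and let $\Delta=\Lambda_2\Lambda_3\cdots\Lambda_r$. A Garside element of a monoid is an element whose left divisors and right divisors coincide, are finite in number and generate the monoid; the simples of a monoid are the divisors of its minimal Garside element, that is, of the Garside element that left-divides every Garside element. Then $\Delta$ is the minimal Garside element of $B^{\oplus}(e,e,r)$, and the simples of $B^{\oplus}(e,e,r)$, i.e. the divisors of $\Delta$, are precisely the elements of the form $p_2p_3\cdots p_r$ where $p_k$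 is a left divisor of $\Lambda_k$ for each $2\le k\le r$. -/

import Mathlib

/-- The element `d` of a monoid is a Garside element: its left divisors and its right divisors
coincide, are finite in number and generate the monoid. In Mathlib `x ∣ d` means
`∃ z, d = x * z`, that is, `x` is a left divisor of `d`. -/
def IsGarsideElement {M : Type*} [Monoid M] (d : M) : Prop :=
  (∀ x : M, x ∣ d ↔ ∃ z : M, d = z * x) ∧
    {x : M | x ∣ d}.Finite ∧ Submonoid.closure {x : M | x ∣ d} = ⊤

/-- The minimal Garside element: a Garside element that divides every Garside element. -/
def IsMinimalGarsideElement {M : Type*} [Monoid M] (d : M) : Prop :=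
  IsGarsideElement d ∧ ∀ d' : M, IsGarsideElement d' → d ∣ d'

/-- The simples of a monoid: the divisors of its minimal Garside element. -/
def IsSimpleElement {M : Type*} [Monoid M] (x : M) : Prop :=
  ∃ d : M, IsMinimalGarsideElement d ∧ x ∣ d

namespace BraidMonoid

/-- The generators `t_i` for `i ∈ ℤ/e`, and `s_j` for `3 ≤ j ≤ r`. -/
inductive Gen (e r : ℕ) : Type
  | t (i : ZMod e) : Gen e r
  | s (j : ℕ) (h : 3 ≤ j ∧ j ≤ r) : Gen e r

open FreeMonoid in
/-- The defining relations. Those between two generators `s_i`, `s_j` are listed for `i < j`;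
they are symmetric in `i` and `j`. -/
inductive Rel (e r : ℕ) : FreeMonoid (Gen e r) → FreeMonoid (Gen e r) → Prop
  | braid_ss (i j : ℕ) (hi : 3 ≤ i ∧ i ≤ r) (hj : 3 ≤ j ∧ j ≤ r) (hij : i + 1 = j) :
      Rel e r (of (.s i hi) * of (.s j hj) * of (.s i hi))
        (of (.s j hj) * of (.s i hi) * of (.s j hj))
  | comm_ss (i j : ℕ) (hi : 3 ≤ i ∧ i ≤ r) (hj : 3 ≤ j ∧ j ≤ r) (hij : i + 1 < j) :
      Rel e r (of (.s i hi) * of (.s j hj)) (of (.s j hj) * of (.s i hi))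
  | braid_st (h : 3 ≤ 3 ∧ 3 ≤ r) (i : ZMod e) :
      Rel e r (of (.s 3 h) * of (.t i) * of (.s 3 h)) (of (.t i) * of (.s 3 h) * of (.t i))
  | comm_st (j : ℕ) (hj : 3 ≤ j ∧ j ≤ r) (h4 : 4 ≤ j) (i : ZMod e) :
      Rel e r (of (.s j hj) * of (.t i)) (of (.t i) * of (.s j hj))
  | circle (i j : ZMod e) :
      Rel e r (of (.t i) * of (.t (i - 1))) (of (.t j) * of (.t (j - 1)))

end BraidMonoid

/-- The monoid `B⊕(e,e,r)`. -/
abbrev BraidMonoid (e r : ℕ) : Type := PresentedMonoid (BraidMonoid.Rel e r)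

namespace BraidMonoid

/-- The element `t_i`. -/
def t (e r : ℕ) (i : ZMod e) : BraidMonoid e r := PresentedMonoid.of (Rel e r) (.t i)

/-- The element `s_j` for `3 ≤ j ≤ r`; it is only used for these `j`. -/
def s (e r : ℕ) (j : ℕ) : BraidMonoid e r :=
  if h : 3 ≤ j ∧ j ≤ r then PresentedMonoid.of (Rel e r) (.s j h) else 1

/-- The element `τ = t_i t_{i-1}`, written with `i = 1`; see `tau_eq`. -/
def tau (e r : ℕ) : BraidMonoid e r := t e r 1 * t e r (1 - 1)

theorem tau_eq (e r : ℕ) (i : ZMod e) : tau e r = t e r i * t e r (i - 1) :=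
  Quotient.sound (ConGen.Rel.of _ _ (Rel.circle 1 i))

/-- `Λ_2 = τ` and `Λ_k = s_k Λ_{k-1} s_k = s_k ⋯ s_3 τ s_3 ⋯ s_k` for `3 ≤ k ≤ r`; it is only used
for `2 ≤ k ≤ r`. -/
def Lam (e r : ℕ) : ℕ → BraidMonoid e r
  | 0 => tau e r
  | 1 => tau e r
  | 2 => tau e r
  | k + 3 => s e r (k + 3) * Lam e r (k + 2) * s e r (k + 3)

/-- The ordered product `p_2 p_3 ⋯ p_r`. -/
def orderedProd {e : ℕ} (r : ℕ) (p : ℕ → BraidMonoid e r) : BraidMonoid e r :=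
  ((List.range' 2 (r - 1)).map p).prod

/-- `Δ = Λ_2 Λ_3 ⋯ Λ_r`. -/
def Delta (e r : ℕ) : BraidMonoid e r := orderedProd r (Lam e r)

end BraidMonoid

/-! The presentation has one relation `a ⋯ = b ⋯` for each pair of distinct generators. By induction
on length, every solution of `a * u = b * v` is a right multiple of that relation
(`fit_of_gen_mul_eq`); the inductive step is the cube condition for triples of generators
(`Fit.trans_of_fitBelow`). This gives left cancellation, then right cancellation through an
anti-automorphism, and lets divisibility by a generator be computed letter by letter.

Conjugation by `Λ_k` maps the parabolic submonoid below `k` to itself by the shift `t_i ↦ t_{i+1}`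
(`Lam_mul_low`). Hence `Δ * x = shift r x * Δ`, and cancellation identifies left and right divisors
of `Δ`. For minimality, the generators have length one, so they divide every Garside element; and
`Δ` divides each of their common multiples, because `t_0` and `t_1` force `τ`, and `s_{k+1} ∣ Λ_k *
u` forces `Λ_{k+1} ∣ u` (`Lam_dvd_of_gen_dvd`).

If `Λ_2 ⋯ Λ_{k-1} = P * Q` and `Λ_k = p * q`, moving `Q` across `Λ_k` gives `Λ_2 ⋯ Λ_k = P * p * q *
shift (-1) Q`, so ordered products of divisors divide `Δ`. Conversely, a divisor is built letter by
letter in the form `P * p`: by `IsLamSuffix.gen_dvd_mul` the next letter is either the first letter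
of a word for `q`, and joins `p`, or passes through `q` to a divisor of `shift (-1) Q`, and then
joins `P`. -/

namespace BraidMonoid

variable {e r : ℕ}

/-! ### Generators and their positions in the diagram -/

/-- The position of a generator in the diagram: all `t_i` sit at `2`, and `s_j` sits at `j`. -/
def Gen.pos : Gen e r → ℕ
  | .t _ => 2
  | .s j _ => j

/-- The generator that completes a `t_i` to `τ`; it fixes the `s_j`. -/
def Gen.pred : Gen e r → Gen e r
  | .t i => .t (i - 1)
  | .s j h => .s j h

@[simp] theorem Gen.pos_pred (a : Gen e r) : a.pred.pos = a.pos := by cases a <;> rfl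

/-- The generators `a` and `b` commute. -/
def Far (a b : Gen e r) : Prop := a.pos + 1 < b.pos ∨ b.pos + 1 < a.pos

/-- The generators `a` and `b` satisfy a braid relation of length three. -/
def Adj (a b : Gen e r) : Prop := a.pos + 1 = b.pos ∨ b.pos + 1 = a.pos

theorem Far.symm {a b : Gen e r} (h : Far a b) : Far b a := Or.symm h

theorem Adj.symm {a b : Gen e r} (h : Adj a b) : Adj b a := Or.symm h

theorem Gen.eq_t_of_pos_eq {a b : Gen e r} (hne : a ≠ b) (h : a.pos = b.pos) :
    ∃ i j, i ≠ j ∧ a = .t i ∧ b = .t j := by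
  cases a with
  | t i =>
    cases b with
    | t j => exact ⟨i, j, fun h => hne (by rw [h]), rfl, rfl⟩
    | s j hj => simp only [Gen.pos] at h; omega
  | s i hi =>
    cases b with
    | t j => simp only [Gen.pos] at h; omega
    | s j hj => simp only [Gen.pos] at h; subst h; exact absurd rfl hne

/-- The generator `b` serves only to force `a` to be some `t_i`; then `1 ≠ 0` in `ZMod e` decides.
-/
theorem Gen.pred_ne_self (he : 2 ≤ e) {a b : Gen e r} (hne : a ≠ b) (h : a.pos = b.pos) :
    a ≠ a.pred := by
  obtain ⟨i, j, -, rfl, rfl⟩ := Gen.eq_t_of_pos_eq hne h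
  have : Fact (1 < e) := ⟨he⟩
  intro h
  simp only [Gen.pred, Gen.t.injEq] at h
  have h2 : (1 : ZMod e) = 0 := by linear_combination h
  exact one_ne_zero h2

theorem Gen.pred_ne_pred {a b : Gen e r} (hne : a ≠ b) (h : a.pos = b.pos) :
    a.pred ≠ b.pred := by
  obtain ⟨i, j, hij, rfl, rfl⟩ := Gen.eq_t_of_pos_eq hne h
  simpa [Gen.pred] using hij

/-- The element of the monoid given by a generator. -/
def gen (a : Gen e r) : BraidMonoid e r := PresentedMonoid.of (Rel e r) a

theorem Far.comm {a b : Gen e r} (h : Far a b) (z : BraidMonoid e r) :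
    gen a * (gen b * z) = gen b * (gen a * z) := by
  have key : ∀ a b : Gen e r, a.pos + 1 < b.pos → gen a * gen b = gen b * gen a := by
    intro a b h
    cases a with
    | t i =>
      cases b with
      | t j => simp [Gen.pos] at h
      | s j hj => exact (PresentedMonoid.mk_eq_mk_of_rel (Rel.comm_st j hj h i)).symm
    | s i hi =>
      cases b with
      | t j => simp only [Gen.pos] at h; omega
      | s j hj => exact PresentedMonoid.mk_eq_mk_of_rel (Rel.comm_ss i j hi hj h)
  rw [← mul_assoc, ← mul_assoc]
  rcases h with h | h
  · rw [key _ _ h]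
  · rw [key _ _ h]

theorem Adj.braid {a b : Gen e r} (h : Adj a b) (z : BraidMonoid e r) :
    gen a * (gen b * (gen a * z)) = gen b * (gen a * (gen b * z)) := by
  have key : ∀ a b : Gen e r, a.pos + 1 = b.pos →
      gen a * gen b * gen a = gen b * gen a * gen b := by
    intro a b h
    cases a with
    | t i =>
      cases b with
      | t j => simp [Gen.pos] at h
      | s j hj =>
        simp only [Gen.pos] at h
        obtain rfl : j = 3 := by omega
        exact (PresentedMonoid.mk_eq_mk_of_rel (Rel.braid_st hj i)).symm
    | s i hi =>
      cases b with
      | t j => simp only [Gen.pos] at h; omega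
      | s j hj => exact PresentedMonoid.mk_eq_mk_of_rel (Rel.braid_ss i j hi hj h)
  simp only [← mul_assoc]
  rcases h with h | h
  · rw [key _ _ h]
  · rw [key _ _ h]

theorem circle {a b : Gen e r} (h : a.pos = b.pos) (z : BraidMonoid e r) :
    gen a * (gen a.pred * z) = gen b * (gen b.pred * z) := by
  by_cases hne : a = b
  · rw [hne]
  obtain ⟨i, j, -, rfl, rfl⟩ := Gen.eq_t_of_pos_eq hne h
  have := PresentedMonoid.mk_eq_mk_of_rel (Rel.circle (r := r) i j)
  rw [← mul_assoc, ← mul_assoc]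
  exact congrArg (· * z) this

/-- Moving a `t` across `s_3 τ s_3` shifts its index. -/
theorem circle_shift {a b : Gen e r} (h : Adj a b) (z : BraidMonoid e r) :
    gen b * (gen a * (gen a.pred * (gen b * (gen a.pred.pred * z)))) =
      gen a.pred * (gen b * (gen a.pred * (gen a.pred.pred * (gen b * z)))) := by
  have h1 : Adj a.pred b := by simpa [Adj] using h
  have h2 : Adj a.pred.pred b := by simpa [Adj] using h
  rw [circle (a := a) (b := a.pred) (by simp), h2.braid, h1.symm.braid]

/-! ### Length -/

/-- The length homomorphism. -/
def lengthHom (e r : ℕ) : BraidMonoid e r →* Multiplicative ℕ :=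
  PresentedMonoid.lift (fun _ => Multiplicative.ofAdd 1) (by
    intro a b h
    cases h <;> simp)

/-- The length of an element in the generators. -/
def len (x : BraidMonoid e r) : ℕ := Multiplicative.toAdd (lengthHom e r x)

@[simp] theorem len_one : len (1 : BraidMonoid e r) = 0 := by simp [len]

@[simp] theorem len_mul (x y : BraidMonoid e r) : len (x * y) = len x + len y := by simp [len]

@[simp] theorem len_gen (a : Gen e r) : len (gen a) = 1 := rfl

theorem len_mk (x : FreeMonoid (Gen e r)) : len (PresentedMonoid.mk (Rel e r) x) = x.length := by
  induction x with
  | one => simp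
  | of a => exact len_gen a
  | mul x y hx hy => simp [hx, hy]

/-! ### Common multiples of two generators -/

/-- The shape of the solutions `u`, `v` of `a * u = b * v`. -/
inductive Fit : Gen e r → BraidMonoid e r → Gen e r → BraidMonoid e r → Prop
  | refl (a : Gen e r) (u : BraidMonoid e r) : Fit a u a u
  | circle {a b : Gen e r} (hne : a ≠ b) (h : a.pos = b.pos) (w : BraidMonoid e r) :
      Fit a (gen a.pred * w) b (gen b.pred * w)
  | far {a b : Gen e r} (h : Far a b) (w : BraidMonoid e r) : Fit a (gen b * w) b (gen a * w)
  | adj {a b : Gen e r} (h : Adj a b) (w : BraidMonoid e r) :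
      Fit a (gen b * (gen a * w)) b (gen a * (gen b * w))

namespace Fit

theorem symm {a b : Gen e r} {u v : BraidMonoid e r} (h : Fit a u b v) : Fit b v a u := by
  cases h with
  | refl => exact .refl _ _
  | circle hne h w => exact .circle hne.symm h.symm w
  | far h w => exact .far h.symm w
  | adj h w => exact .adj h.symm w

theorem mul_right {a b : Gen e r} {u v : BraidMonoid e r} (h : Fit a u b v)
    (z : BraidMonoid e r) : Fit a (u * z) b (v * z) := by
  cases h with
  | refl => exact .refl _ _
  | circle hne h w => simpa only [mul_assoc] using Fit.circle hne h (w * z)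
  | far h w => simpa only [mul_assoc] using Fit.far h (w * z)
  | adj h w => simpa only [mul_assoc] using Fit.adj h (w * z)

theorem eq {a : Gen e r} {u v : BraidMonoid e r} (h : Fit a u a v) : u = v := by
  cases h with
  | refl => rfl
  | circle hne h w => exact absurd rfl hne
  | far h w => simp [Far] at h
  | adj h w => simp [Adj] at h

theorem exists_circle {a b : Gen e r} {u v : BraidMonoid e r} (hne : a ≠ b) (hp : a.pos = b.pos)
    (h : Fit a u b v) : ∃ w, u = gen a.pred * w ∧ v = gen b.pred * w := by
  cases h with
  | refl => exact absurd rfl hne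
  | circle hne h w => exact ⟨w, rfl, rfl⟩
  | far h w => simp only [Far] at h; omega
  | adj h w => simp only [Adj] at h; omega

theorem exists_far {a b : Gen e r} {u v : BraidMonoid e r} (hp : Far a b)
    (h : Fit a u b v) : ∃ w, u = gen b * w ∧ v = gen a * w := by
  simp only [Far] at hp
  cases h with
  | refl => omega
  | circle hne h w => omega
  | far h w => exact ⟨w, rfl, rfl⟩
  | adj h w => simp only [Adj] at h; omega

theorem exists_adj {a b : Gen e r} {u v : BraidMonoid e r} (hp : Adj a b)
    (h : Fit a u b v) : ∃ w, u = gen b * (gen a * w) ∧ v = gen a * (gen b * w) := by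
  simp only [Adj] at hp
  cases h with
  | refl => omega
  | circle hne h w => omega
  | far h w => simp only [Far] at h; omega
  | adj h w => exact ⟨w, rfl, rfl⟩

theorem far_mul_left {a b c : Gen e r} {u v : BraidMonoid e r} (ha : Far c a) (hb : Far c b)
    (h : Fit a u b v) : Fit a (gen c * u) b (gen c * v) := by
  cases h with
  | refl => exact .refl _ _
  | circle hne h w =>
    have ha' : Far c a.pred := by simpa [Far] using ha
    have hb' : Far c b.pred := by simpa [Far] using hb
    rw [ha'.comm, hb'.comm]
    exact .circle hne h _
  | far h w =>
    rw [ha.comm, hb.comm]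
    exact .far h _
  | adj h w =>
    rw [ha.comm, hb.comm, ha.comm, hb.comm]
    exact .adj h _

end Fit

/-- All equations `a * u = b * v` of length less than `n` have the expected solutions. -/
def FitBelow (e r n : ℕ) : Prop :=
  ∀ (a b : Gen e r) (u v : BraidMonoid e r), len u + 1 < n → gen a * u = gen b * v → Fit a u b v

/-! ### The cube condition for triples of generators -/

section Cube

variable {n : ℕ} {a b c : Gen e r} {x y : BraidMonoid e r}

theorem cube_circle_circle (H : FitBelow e r n) (hn : len x + 2 ≤ n)
    (hac : a.pos = c.pos) (hcb : c.pos = b.pos) (h : gen c.pred * x = gen c.pred * y) :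
    Fit a (gen a.pred * x) b (gen b.pred * y) := by
  obtain rfl := (H _ _ _ _ (by omega) h).eq
  by_cases hab : a = b
  · subst hab; exact .refl _ _
  · exact .circle hab (hac.trans hcb) _

theorem cube_circle_far (H : FitBelow e r n) (hn : len x + 2 ≤ n) (hac : a.pos = c.pos)
    (hcb : Far c b) (h : gen c.pred * x = gen b * y) :
    Fit a (gen a.pred * x) b (gen c * y) := by
  have hcb' : Far c.pred b := by simpa [Far] using hcb
  have hab : Far a b := by simpa [Far, hac] using hcb
  have hab' : Far a.pred b := by simpa [Far] using hab
  obtain ⟨z, rfl, rfl⟩ := (H _ _ _ _ (by omega) h).exists_far hcb'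
  rw [hab'.comm, circle (a := c) (b := a) hac.symm]
  exact .far hab _

/-- The triple is `t_i`, `t_j`, `s_3`. Solving the shorter equations in turn exhibits `x` and `y` as
right multiples of explicit words; `circle_shift` then brings both sides to the form of the braid
relation between `a` and `b`. -/
theorem cube_circle_adj (he : 2 ≤ e) (H : FitBelow e r n) (hn : len x + 2 ≤ n) (hne : a ≠ c)
    (hac : a.pos = c.pos) (hcb : Adj c b) (h : gen c.pred * x = gen b * (gen c * y)) :
    Fit a (gen a.pred * x) b (gen c * (gen b * y)) := by
  have hab : Adj a b := by simpa [Adj, hac] using hcb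
  have hab' : Adj a.pred b := by simpa [Adj] using hab
  have hcb' : Adj c.pred b := by simpa [Adj] using hcb
  have hcb'' : Adj c.pred.pred b := by simpa [Adj] using hcb
  obtain ⟨x', rfl, hy⟩ := (H _ _ _ _ (by omega) h).exists_adj hcb'
  have hl := congrArg len hy
  simp only [len_mul, len_gen] at hn hl
  obtain ⟨y', rfl, hx⟩ := (H _ _ _ _ (by omega) hy).exists_circle
    (Gen.pred_ne_self he hne.symm hac.symm) (by simp)
  obtain ⟨z, rfl, rfl⟩ := (H _ _ _ _ (by omega) hx).exists_adj hcb''.symm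
  have e1 := circle (a := c.pred) (b := a.pred) (by simp [hac]) (gen b * z)
  have e2 := circle (a := c.pred) (b := a.pred) (by simp [hac]) z
  have e3 := circle_shift hab z
  rw [e1, ← e3, ← hcb'.braid, e2, circle (a := c) (b := a) hac.symm, hab'.braid]
  exact .adj hab _

theorem cube_far_adj (H : FitBelow e r n) (hn : len x + 2 ≤ n)
    (hac : Far a c) (hcb : Adj c b) (h : gen a * x = gen b * (gen c * y)) :
    Fit a (gen c * x) b (gen c * (gen b * y)) := by
  -- Equal positions are excluded, since `c` is adjacent to `b` but far from `a`. If `a` and `b` are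
  -- adjacent, the triple has type `A_3` with `b` in the middle.
  have hab : Far a b ∨ Adj a b := by
    simp only [Far, Adj] at *; omega
  rcases hab with hab | hab
  · obtain ⟨x', rfl, hy⟩ := (H _ _ _ _ (by omega) h).exists_far hab
    have hl := congrArg len hy
    simp only [len_mul, len_gen] at hn hl
    obtain ⟨z, rfl, rfl⟩ := (H _ _ _ _ (by omega) hy).exists_far hac.symm
    rw [hcb.braid, hab.symm.comm, hac.symm.comm]
    exact .far hab _
  · obtain ⟨x', rfl, hy⟩ := (H _ _ _ _ (by omega) h).exists_adj hab
    have hl := congrArg len hy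
    simp only [len_mul, len_gen] at hn hl
    obtain ⟨y', rfl, hx⟩ := (H _ _ _ _ (by omega) hy).exists_far hac.symm
    have hl' := congrArg len hx
    simp only [len_mul, len_gen] at hn hl'
    obtain ⟨z, rfl, rfl⟩ := (H _ _ _ _ (by omega) hx).exists_adj hcb.symm
    rw [hac.comm, hcb.braid, ← hab.braid, hac.symm.comm (gen b * (gen a * z)),
      ← hab.braid (gen c * z), hac.symm.comm, hac.comm z, hcb.braid (gen a * z)]
    exact .adj hab _

theorem cube_adj_adj (H : FitBelow e r n) (hn : len x + 3 ≤ n)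
    (hac : Adj a c) (hcb : Adj c b) (h : gen a * (gen c * x) = gen b * (gen c * y)) :
    Fit a (gen c * (gen a * x)) b (gen c * (gen b * y)) := by
  have hl0 := congrArg len h
  simp only [len_mul, len_gen] at hl0
  by_cases hne : a = b
  · subst hne
    have h1 := (H _ _ _ _ (by simp; omega) h).eq
    rw [(H _ _ _ _ (by omega) h1).eq]
    exact .refl _ _
  -- Both positions differ from that of `c` by one, so they agree (two `t`s next to `s_3`) or differ
  -- by two (type `A_3` with `c` in the middle).
  have hab : a.pos = b.pos ∨ Far a b := by
    simp only [Far, Adj] at *; omega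
  rcases hab with hab | hab
  · have hac' : Adj c a.pred := by simpa [Adj, or_comm] using hac
    have hcb' : Adj c b.pred := by simpa [Adj] using hcb
    obtain ⟨x', hx, hy⟩ := (H _ _ _ _ (by simp; omega) h).exists_circle hne hab
    obtain ⟨x'', rfl, rfl⟩ := (H _ _ _ _ (by omega) hx).exists_adj hac'
    obtain ⟨y'', rfl, hxy⟩ := (H _ _ _ _ (by omega) hy).exists_adj hcb'
    simp only [len_mul, len_gen] at hn
    have hxy' := (H _ _ _ _ (by simp; omega) hxy).eq
    obtain ⟨z, rfl, rfl⟩ := (H _ _ _ _ (by omega) hxy').exists_circle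
      (Gen.pred_ne_pred hne hab) (by simpa using hab)
    rw [circle_shift hac, circle_shift hcb.symm,
      circle (a := a.pred) (b := b.pred) (by simpa using hab)]
    exact .circle hne hab _
  · obtain ⟨x', hx, hy⟩ := (H _ _ _ _ (by simp; omega) h).exists_far hab
    obtain ⟨x'', rfl, rfl⟩ := (H _ _ _ _ (by omega) hx).exists_adj hcb
    obtain ⟨y'', rfl, hxy⟩ := (H _ _ _ _ (by omega) hy).exists_adj hac.symm
    simp only [len_mul, len_gen] at hn
    have hxy' := (H _ _ _ _ (by simp; omega) hxy).eq
    obtain ⟨z, rfl, rfl⟩ := (H _ _ _ _ (by omega) hxy').exists_far hab.symm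
    have e1 : gen c * (gen a * (gen b * (gen c * (gen a * z)))) =
        gen b * (gen c * (gen b * (gen a * (gen c * z)))) := by
      rw [hab.comm, hac.braid, hcb.braid]
    have e2 : gen c * (gen b * (gen a * (gen c * (gen b * z)))) =
        gen a * (gen c * (gen b * (gen a * (gen c * z)))) := by
      rw [hab.symm.comm, ← hcb.braid, ← hac.braid, hab.comm]
    rw [e1, e2]
    exact .far hab _

end Cube

/-- This is the cube condition: three first letters `a`, `c`, `b` of one element, with the outer
pairs already understood. The equation between the two forms of the tail after `c` is shorter by one
letter, so `H` applies to it. Keeping `w = w'` as a hypothesis lets both fits be split into cases.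
-/
theorem Fit.trans_of_fitBelow (he : 2 ≤ e) {n : ℕ} (H : FitBelow e r n) {a b c : Gen e r}
    {u v w w' : BraidMonoid e r} (hn : len w + 1 ≤ n) (hw : w = w')
    (h₁ : Fit a u c w) (h₂ : Fit c w' b v) : Fit a u b v := by
  have hl := congrArg len hw
  cases h₁ with
  | refl => rw [hw]; exact h₂
  | circle hne hac x =>
    cases h₂ with
    | refl => rw [← hw]; exact .circle hne hac x
    | circle hne' hcb y =>
      simp only [len_mul, len_gen] at hn hl
      exact cube_circle_circle H (by omega) hac hcb hw
    | far hcb y =>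
      simp only [len_mul, len_gen] at hn hl
      exact cube_circle_far H (by omega) hac hcb hw
    | adj hcb y =>
      simp only [len_mul, len_gen] at hn hl
      exact cube_circle_adj he H (by omega) hne hac hcb hw
  | far hac x =>
    cases h₂ with
    | refl => rw [← hw]; exact .far hac x
    | circle hne hcb y =>
      simp only [len_mul, len_gen] at hn hl
      exact (cube_circle_far H (by omega) hcb.symm hac.symm hw.symm).symm
    | far hcb y =>
      simp only [len_mul, len_gen] at hn hl
      exact (H _ _ _ _ (by omega) hw).far_mul_left hac.symm hcb
    | adj hcb y =>
      simp only [len_mul, len_gen] at hn hl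
      exact cube_far_adj H (by omega) hac hcb hw
  | adj hac x =>
    cases h₂ with
    | refl => rw [← hw]; exact .adj hac x
    | circle hne hcb y =>
      simp only [len_mul, len_gen] at hn hl
      exact (cube_circle_adj he H (by omega) hne.symm hcb.symm hac.symm hw.symm).symm
    | far hcb y =>
      simp only [len_mul, len_gen] at hn hl
      exact (cube_far_adj H (by omega) hcb.symm hac.symm hw.symm).symm
    | adj hcb y =>
      simp only [len_mul, len_gen] at hn hl
      exact cube_adj_adj H (by omega) hac hcb hw

/-! ### From words to elements: induction on the congruence -/

/-- Two words are both empty, or they solve the equation given by their first letters in the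
expected way. -/
def WordFit (x y : FreeMonoid (Gen e r)) : Prop :=
  (x = 1 ∧ y = 1) ∨ ∃ a u b v, x = FreeMonoid.of a * u ∧ y = FreeMonoid.of b * v ∧
    Fit a (PresentedMonoid.mk (Rel e r) u) b (PresentedMonoid.mk (Rel e r) v)

theorem WordFit.of_rel {x y : FreeMonoid (Gen e r)} (h : Rel e r x y) : WordFit x y := by
  cases h with
  | braid_ss i j hi hj hij =>
    refine .inr ⟨_, _, _, _, mul_assoc _ _ _, mul_assoc _ _ _, ?_⟩
    exact Fit.adj (a := .s i hi) (b := .s j hj) (.inl hij) 1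
  | comm_ss i j hi hj hij =>
    refine .inr ⟨_, _, _, _, rfl, rfl, ?_⟩
    exact Fit.far (a := .s i hi) (b := .s j hj) (.inl hij) 1
  | braid_st h i =>
    refine .inr ⟨_, _, _, _, mul_assoc _ _ _, mul_assoc _ _ _, ?_⟩
    exact Fit.adj (a := .s 3 h) (b := .t i) (.inr rfl) 1
  | comm_st j hj h4 i =>
    refine .inr ⟨_, _, _, _, rfl, rfl, ?_⟩
    exact Fit.far (a := .s j hj) (b := .t i) (.inr h4) 1
  | circle i j =>
    refine .inr ⟨_, _, _, _, rfl, rfl, ?_⟩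
    by_cases hij : i = j
    · subst hij; exact .refl _ _
    · exact Fit.circle (a := .t i) (b := .t j) (by simpa using hij) rfl 1

theorem length_eq_of_rel {x y : FreeMonoid (Gen e r)} (h : ConGen.Rel (Rel e r) x y) :
    x.length = y.length := by
  have : PresentedMonoid.mk (Rel e r) x = PresentedMonoid.mk (Rel e r) y :=
    PresentedMonoid.mk_eq_mk_iff.2 h
  rw [← len_mk, this, len_mk]

theorem eq_one_or_eq_of_mul {α : Type*} (x : FreeMonoid α) :
    x = 1 ∨ ∃ a u, x = FreeMonoid.of a * u := by
  cases x using FreeMonoid.casesOn with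
  | one => exact .inl rfl
  | of_mul a u => exact .inr ⟨a, u, rfl⟩

theorem of_mul_inj {α : Type*} {a b : α} {u v : FreeMonoid α}
    (h : FreeMonoid.of a * u = FreeMonoid.of b * v) : a = b ∧ u = v :=
  List.cons.inj h

/-- Induction on the derivation of the congruence: defining relations fit by design, transitivity is
the cube condition, and a product only lengthens the tails unless its first factor is empty. -/
theorem wordFit_of_conGen (he : 2 ≤ e) {n : ℕ} (H : FitBelow e r n) {x y : FreeMonoid (Gen e r)}
    (h : ConGen.Rel (Rel e r) x y) (hn : x.length ≤ n) : WordFit x y := by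
  induction h with
  | of x y h => exact .of_rel h
  | refl x =>
    rcases eq_one_or_eq_of_mul x with rfl | ⟨a, u, rfl⟩
    · exact .inl ⟨rfl, rfl⟩
    · exact .inr ⟨_, _, _, _, rfl, rfl, .refl _ _⟩
  | symm h ih =>
    rcases ih (by rw [length_eq_of_rel h]; exact hn) with ⟨rfl, rfl⟩ | ⟨a, u, b, v, rfl, rfl, hf⟩
    · exact .inl ⟨rfl, rfl⟩
    · exact .inr ⟨_, _, _, _, rfl, rfl, hf.symm⟩
  | trans h₁ h₂ ih₁ ih₂ =>
    have hl := length_eq_of_rel h₁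
    have f₂ := ih₂ (by omega)
    rcases ih₁ hn with ⟨rfl, rfl⟩ | ⟨a, u, c, w, rfl, rfl, hf₁⟩
    · exact f₂
    rcases f₂ with ⟨h0, -⟩ | ⟨c', w', b, v, hc, rfl, hf₂⟩
    · exact absurd h0 (by intro h; simpa using congrArg FreeMonoid.length h)
    obtain ⟨rfl, rfl⟩ := of_mul_inj hc
    refine .inr ⟨_, _, _, _, rfl, rfl, hf₁.trans_of_fitBelow he H ?_ rfl hf₂⟩
    rw [len_mk]
    simp at hl hn
    omega
  | @mul x x' y y' h₁ h₂ ih₁ ih₂ =>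
    rw [FreeMonoid.length_mul] at hn
    have hy : PresentedMonoid.mk (Rel e r) y = PresentedMonoid.mk (Rel e r) y' :=
      PresentedMonoid.mk_eq_mk_iff.2 h₂
    rcases ih₁ (by omega) with ⟨rfl, rfl⟩ | ⟨a, u, b, v, rfl, rfl, hf⟩
    · simpa using ih₂ (by omega)
    · refine .inr ⟨_, _, _, _, mul_assoc _ _ _, mul_assoc _ _ _, ?_⟩
      rw [map_mul, map_mul, hy]
      exact hf.mul_right _

theorem fitBelow (he : 2 ≤ e) (n : ℕ) : FitBelow e r n := by
  induction n with
  | zero => intro a b u v h; omega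
  | succ n ih =>
    intro a b u v hn h
    obtain ⟨u, rfl⟩ := PresentedMonoid.surjective_mk u
    obtain ⟨v, rfl⟩ := PresentedMonoid.surjective_mk v
    have h' : ConGen.Rel (Rel e r) (FreeMonoid.of a * u) (FreeMonoid.of b * v) :=
      PresentedMonoid.mk_eq_mk_iff.1 h
    rw [len_mk] at hn
    rcases wordFit_of_conGen he ih h' (by simp; omega) with
      ⟨h0, -⟩ | ⟨a', u', b', v', ha, hb, hf⟩
    · exact absurd h0 (by intro h; simpa using congrArg FreeMonoid.length h)
    · obtain ⟨rfl, rfl⟩ := of_mul_inj ha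
      obtain ⟨rfl, rfl⟩ := of_mul_inj hb
      exact hf

/-- The solutions of an equation `a * u = b * v` with generators `a`, `b`. -/
theorem fit_of_gen_mul_eq (he : 2 ≤ e) {a b : Gen e r} {u v : BraidMonoid e r}
    (h : gen a * u = gen b * v) : Fit a u b v :=
  fitBelow he (len u + 2) a b u v (by omega) h

/-! ### Induction principles and cancellation -/

theorem induction_left {p : BraidMonoid e r → Prop} (x : BraidMonoid e r) (one : p 1)
    (gen_mul : ∀ a x, p x → p (gen a * x)) : p x :=
  Submonoid.induction_of_closure_eq_top_left (PresentedMonoid.closure_range_of (Rel e r)) x one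
    (by rintro _ ⟨a, rfl⟩ y hy; exact gen_mul a y hy)

theorem induction_right {p : BraidMonoid e r → Prop} (x : BraidMonoid e r) (one : p 1)
    (mul_gen : ∀ x a, p x → p (x * gen a)) : p x :=
  Submonoid.induction_of_closure_eq_top_right (PresentedMonoid.closure_range_of (Rel e r)) x one
    (by rintro y _ ⟨a, rfl⟩ hy; exact mul_gen y a hy)

theorem left_cancel (he : 2 ≤ e) (x : BraidMonoid e r) {u v : BraidMonoid e r}
    (h : x * u = x * v) : u = v := by
  induction x using induction_left with
  | one => simpa using h
  | gen_mul a x ih =>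
    rw [mul_assoc, mul_assoc] at h
    exact ih (fit_of_gen_mul_eq he h).eq

theorem dvd_of_mul_dvd_mul_left (he : 2 ≤ e) (x : BraidMonoid e r) {u v : BraidMonoid e r}
    (h : x * u ∣ x * v) : u ∣ v := by
  obtain ⟨w, hw⟩ := h
  exact ⟨w, left_cancel he x (by rw [hw, mul_assoc])⟩

/-- The anti-automorphism `t_i ↦ t_{-i}`, `s_j ↦ s_j`, on generators. -/
def Gen.neg : Gen e r → Gen e r
  | .t i => .t (-i)
  | .s j h => .s j h

@[simp] theorem Gen.neg_neg (a : Gen e r) : a.neg.neg = a := by cases a <;> simp [Gen.neg]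

/-- The anti-automorphism `t_i ↦ t_{-i}`, `s_j ↦ s_j`, as a homomorphism to the opposite monoid. -/
def revHom (e r : ℕ) : BraidMonoid e r →* (BraidMonoid e r)ᵐᵒᵖ :=
  PresentedMonoid.lift (fun a => MulOpposite.op (gen a.neg)) (by
    intro x y h
    cases h with
    | braid_ss i j hi hj hij =>
      simpa [← MulOpposite.op_mul] using
        (Adj.braid (a := (Gen.s i hi : Gen e r).neg) (b := (Gen.s j hj).neg) (.inl hij) 1)
    | comm_ss i j hi hj hij =>
      simpa [← MulOpposite.op_mul] using
        (Far.comm (a := (Gen.s i hi : Gen e r).neg) (b := (Gen.s j hj).neg) (.inl hij) 1).symm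
    | braid_st h i =>
      simpa [← MulOpposite.op_mul] using
        (Adj.braid (a := (Gen.s 3 h : Gen e r).neg) (b := (Gen.t i).neg) (.inr rfl) 1)
    | comm_st j hj h4 i =>
      simpa [← MulOpposite.op_mul] using
        (Far.comm (a := (Gen.s j hj : Gen e r).neg) (b := (Gen.t i).neg) (.inr h4) 1).symm
    | circle i j =>
      -- Reversal turns `t_i t_{i-1}` into `t_{i-1} t_i`, whose indices increase; negating them
      -- restores a decreasing step, from `-(i - 1)` to `-i`.
      have := circle (a := (Gen.t (-(i - 1)) : Gen e r)) (b := .t (-(j - 1))) rfl 1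
      simpa [← MulOpposite.op_mul, Gen.neg, Gen.pred] using this)

/-- The anti-automorphism `t_i ↦ t_{-i}`, `s_j ↦ s_j`. -/
def rev (x : BraidMonoid e r) : BraidMonoid e r := (revHom e r x).unop

theorem rev_mul (x y : BraidMonoid e r) : rev (x * y) = rev y * rev x := by simp [rev]

theorem rev_gen (a : Gen e r) : rev (gen a) = gen a.neg := rfl

theorem rev_rev (x : BraidMonoid e r) : rev (rev x) = x := by
  induction x using induction_left with
  | one => simp [rev]
  | gen_mul a x ih => rw [rev_mul, rev_mul, ih, rev_gen, rev_gen, Gen.neg_neg]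

theorem right_cancel (he : 2 ≤ e) (x : BraidMonoid e r) {u v : BraidMonoid e r}
    (h : u * x = v * x) : u = v := by
  have h' := congrArg rev h
  rw [rev_mul, rev_mul] at h'
  rw [← rev_rev u, left_cancel he _ h', rev_rev]

/-! ### The shift automorphism -/

/-- The shift `t_i ↦ t_{i+c}`, `s_j ↦ s_j` on generators. -/
def Gen.shift (c : ZMod e) : Gen e r → Gen e r
  | .t i => .t (i + c)
  | .s j h => .s j h

@[simp] theorem Gen.pos_shift (c : ZMod e) (a : Gen e r) : (a.shift c).pos = a.pos := by
  cases a <;> rfl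

@[simp] theorem Gen.shift_shift (c d : ZMod e) (a : Gen e r) :
    (a.shift c).shift d = a.shift (c + d) := by
  cases a <;> simp [Gen.shift, add_assoc]

@[simp] theorem Gen.shift_zero (a : Gen e r) : a.shift 0 = a := by cases a <;> simp [Gen.shift]

theorem Gen.shift_eq_self (c : ZMod e) {a : Gen e r} (h : 3 ≤ a.pos) : a.shift c = a := by
  cases a with
  | t i => simp [Gen.pos] at h
  | s j hj => rfl

/-- The automorphism `t_i ↦ t_{i+c}`, `s_j ↦ s_j`. -/
def shift (c : ZMod e) : BraidMonoid e r →* BraidMonoid e r :=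
  PresentedMonoid.lift (fun a => gen (a.shift c)) (by
    intro x y h
    cases h with
    | braid_ss i j hi hj hij => exact PresentedMonoid.mk_eq_mk_of_rel (.braid_ss i j hi hj hij)
    | comm_ss i j hi hj hij => exact PresentedMonoid.mk_eq_mk_of_rel (.comm_ss i j hi hj hij)
    | braid_st h i => exact PresentedMonoid.mk_eq_mk_of_rel (.braid_st h _)
    | comm_st j hj h4 i => exact PresentedMonoid.mk_eq_mk_of_rel (.comm_st j hj h4 _)
    | circle i j =>
      have := circle (a := (Gen.t (i + c) : Gen e r)) (b := .t (j + c)) rfl 1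
      simpa [Gen.shift, Gen.pred, sub_add_eq_add_sub] using this)

@[simp] theorem shift_gen (c : ZMod e) (a : Gen e r) : shift c (gen a) = gen (a.shift c) := rfl

theorem shift_shift (c d : ZMod e) (x : BraidMonoid e r) :
    shift d (shift c x) = shift (c + d) x := by
  induction x using induction_left with
  | one => simp
  | gen_mul a x ih => simp [ih]

theorem shift_zero (x : BraidMonoid e r) : shift 0 x = x := by
  induction x using induction_left with
  | one => simp
  | gen_mul a x ih => simp [ih]

theorem shift_neg_shift (c : ZMod e) (x : BraidMonoid e r) : shift c (shift (-c) x) = x := by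
  rw [shift_shift, neg_add_cancel, shift_zero]

/-! ### Standard parabolic submonoids -/

/-- The homomorphism that is `1` on generators of position at most `k`, and `0` on the others. -/
def supp (k : ℕ) : BraidMonoid e r →* ℕ :=
  PresentedMonoid.lift (fun a => if a.pos ≤ k then 1 else 0) (by
    intro x y h
    -- The values `0` and `1` are idempotent, and the two sides of each relation involve the same
    -- positions.
    cases h <;> simp only [map_mul, FreeMonoid.lift_eval_of, Gen.pos] <;> grind)

theorem supp_gen_eq_one {k : ℕ} {a : Gen e r} : supp k (gen a) = 1 ↔ a.pos ≤ k := by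
  change (if a.pos ≤ k then 1 else 0) = 1 ↔ _
  simp

theorem supp_mul_eq_one {k : ℕ} {x y : BraidMonoid e r} :
    supp k (x * y) = 1 ↔ supp k x = 1 ∧ supp k y = 1 := by
  rw [map_mul, mul_eq_one]

theorem pos_le_of_dvd {k : ℕ} {a : Gen e r} {x : BraidMonoid e r} (h : gen a ∣ x)
    (hx : supp k x = 1) : a.pos ≤ k := by
  obtain ⟨y, rfl⟩ := h
  exact supp_gen_eq_one.1 (supp_mul_eq_one.1 hx).1

theorem supp_mono {k l : ℕ} (hkl : k ≤ l) {x : BraidMonoid e r} (h : supp k x = 1) :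
    supp l x = 1 := by
  induction x using induction_left with
  | one => simp
  | gen_mul a x ih =>
    rw [supp_mul_eq_one, supp_gen_eq_one] at *
    exact ⟨h.1.trans hkl, ih h.2⟩

theorem supp_shift (k : ℕ) (c : ZMod e) (x : BraidMonoid e r) (h : supp k x = 1) :
    supp k (shift c x) = 1 := by
  induction x using induction_left with
  | one => simp
  | gen_mul a x ih =>
    rw [supp_mul_eq_one, supp_gen_eq_one] at h
    rw [map_mul, supp_mul_eq_one, shift_gen, supp_gen_eq_one, Gen.pos_shift]
    exact ⟨h.1, ih h.2⟩

theorem low_comm {k : ℕ} {a : Gen e r} (ha : k + 1 < a.pos) {x : BraidMonoid e r}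
    (hx : supp k x = 1) (z : BraidMonoid e r) : gen a * (x * z) = x * (gen a * z) := by
  induction x using induction_left with
  | one => simp
  | gen_mul b x ih =>
    rw [supp_mul_eq_one, supp_gen_eq_one] at hx
    have hab : Far a b := .inr (by omega)
    rw [mul_assoc, hab.comm, ih hx.2, mul_assoc]

/-! ### Divisibility by a generator -/

/-- This lemma and the next two read off from `Fit` what remains of the condition `gen a ∣ _` once
the letter `b` is removed. -/
theorem dvd_of_far (he : 2 ≤ e) {a b : Gen e r} (hab : Far a b) {u : BraidMonoid e r}
    (h : gen a ∣ gen b * u) : gen a ∣ u := by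
  obtain ⟨w, hw⟩ := h
  obtain ⟨z, rfl, rfl⟩ := (fit_of_gen_mul_eq he hw.symm).exists_far hab
  exact ⟨z, rfl⟩

theorem dvd_of_adj (he : 2 ≤ e) {a b : Gen e r} (hab : Adj a b) {u : BraidMonoid e r}
    (h : gen a ∣ gen b * u) : gen a * gen b ∣ u := by
  obtain ⟨w, hw⟩ := h
  obtain ⟨z, rfl, rfl⟩ := (fit_of_gen_mul_eq he hw.symm).exists_adj hab
  exact ⟨z, by rw [mul_assoc]⟩

theorem dvd_of_circle (he : 2 ≤ e) {a b : Gen e r} (hne : a ≠ b) (hab : a.pos = b.pos)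
    {u : BraidMonoid e r} (h : gen a ∣ gen b * u) : gen b.pred ∣ u := by
  obtain ⟨w, hw⟩ := h
  obtain ⟨z, rfl, rfl⟩ := (fit_of_gen_mul_eq he hw.symm).exists_circle hne hab
  exact ⟨z, rfl⟩

theorem gen_dvd_of_dvd_low_mul (he : 2 ≤ e) {k : ℕ} {a : Gen e r} (ha : k + 1 < a.pos)
    {x u : BraidMonoid e r} (hx : supp k x = 1) (h : gen a ∣ x * u) : gen a ∣ u := by
  induction x using induction_left with
  | one => simpa using h
  | gen_mul b x ih =>
    rw [supp_mul_eq_one, supp_gen_eq_one] at hx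
    rw [mul_assoc] at h
    exact ih hx.2 (dvd_of_far he (.inr (by omega)) h)

theorem low_dvd_of_dvd_gen_mul (he : 2 ≤ e) {k : ℕ} {b : Gen e r} (hb : k + 1 < b.pos)
    {x u : BraidMonoid e r} (hx : supp k x = 1) (h : x ∣ gen b * u) : x ∣ u := by
  induction x using induction_left generalizing u with
  | one => simp
  | gen_mul a x ih =>
    rw [supp_mul_eq_one, supp_gen_eq_one] at hx
    obtain ⟨w, hw⟩ := h
    rw [mul_assoc] at hw
    obtain ⟨z, rfl, h2⟩ :=
      (fit_of_gen_mul_eq he hw).exists_far (.inr (by omega))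
    exact mul_dvd_mul_left _ (ih hx.2 ⟨w, h2.symm⟩)

/-! ### The elements `Λ_k` -/

theorem s_eq_gen {j : ℕ} (h : 3 ≤ j ∧ j ≤ r) : s e r j = gen (.s j h) := by
  rw [s, dif_pos h]; rfl

theorem Gen.pos_le (a : Gen e r) (hr : 2 ≤ r) : a.pos ≤ r := by
  cases a with
  | t i => exact hr
  | s j h => exact h.2

theorem Gen.two_le_pos (a : Gen e r) : 2 ≤ a.pos := by
  cases a with
  | t i => exact le_rfl
  | s j h => exact le_trans (by norm_num) h.1

theorem Gen.exists_eq_t {a : Gen e r} (h : a.pos = 2) : ∃ i, a = .t i := by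
  cases a with
  | t i => exact ⟨i, rfl⟩
  | s j hj => simp only [Gen.pos] at h; omega

theorem s_pos {a : Gen e r} (h : 3 ≤ a.pos) : s e r a.pos = gen a := by
  cases a with
  | t i => simp [Gen.pos] at h
  | s j hj => exact s_eq_gen hj

theorem Gen.exists_pos_eq {j : ℕ} (h3 : 3 ≤ j) (hr : j ≤ r) : ∃ a : Gen e r, a.pos = j :=
  ⟨.s j ⟨h3, hr⟩, rfl⟩

theorem Lam_two_mul {a : Gen e r} (h : a.pos = 2) (z : BraidMonoid e r) :
    Lam e r 2 * z = gen a * (gen a.pred * z) := by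
  obtain ⟨i, rfl⟩ := Gen.exists_eq_t h
  rw [Lam, tau_eq e r i, mul_assoc]
  rfl

theorem Lam_succ_mul {k : ℕ} (hk : 2 ≤ k) {a : Gen e r} (h : a.pos = k + 1)
    (z : BraidMonoid e r) :
    Lam e r (k + 1) * z = gen a * (Lam e r k * (gen a * z)) := by
  obtain ⟨k, rfl⟩ := Nat.exists_eq_add_of_le' hk
  rw [Lam, ← s_pos (a := a) (by omega), h, mul_assoc, mul_assoc]

theorem supp_Lam {k : ℕ} (hk : 2 ≤ k) (hkr : k ≤ r) : supp k (Lam e r k) = 1 := by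
  induction k, hk using Nat.le_induction with
  | base =>
    rw [← mul_one (Lam e r 2), Lam_two_mul (a := .t 0) rfl]
    simp only [supp_mul_eq_one, supp_gen_eq_one, map_one]
    exact ⟨le_rfl, le_rfl, trivial⟩
  | succ k hk ih =>
    obtain ⟨a, ha⟩ := Gen.exists_pos_eq (e := e) (r := r) (j := k + 1) (by omega) hkr
    rw [← mul_one (Lam e r (k + 1)), Lam_succ_mul hk ha]
    simp only [supp_mul_eq_one, supp_gen_eq_one, map_one]
    have := supp_mono (k.le_succ) (ih (by omega))
    exact ⟨ha.le, this, ha.le, trivial⟩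

/-- The outer letters of `Λ_{k+1}` commute with generators below position `k`, which leaves
induction. At position `k > 2`, two braid moves around `Λ_{k-1}` carry the letter across; at `k = 2`
this is `circle_shift`, the source of the index shift. -/
theorem Lam_mul_gen {k : ℕ} (hk : 2 ≤ k) (hkr : k ≤ r) {a : Gen e r} (ha : a.pos < k)
    (z : BraidMonoid e r) :
    Lam e r k * (gen a * z) = gen (a.shift 1) * (Lam e r k * z) := by
  have ha2 := a.two_le_pos
  induction k, hk using Nat.le_induction generalizing z with
  | base => omega
  | succ k hk ih =>
    obtain ⟨b, hb⟩ := Gen.exists_pos_eq (e := e) (r := r) (j := k + 1) (by omega) hkr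
    rw [Lam_succ_mul hk hb, Lam_succ_mul hk hb]
    rcases Nat.lt_or_ge a.pos k with h | h
    · have hba : Far b a := .inr (by omega)
      have hba' : Far b (a.shift 1) := by simpa [Far] using hba
      rw [hba.comm, ih (by omega) h, hba'.comm]
    · rcases Nat.lt_or_ge 2 k with h2 | h2
      · obtain ⟨k, rfl⟩ : ∃ l, k = l + 1 := ⟨k - 1, by omega⟩
        have hab : Adj a b := .inl (by omega)
        have hbL : ∀ z, gen b * (Lam e r k * z) = Lam e r k * (gen b * z) :=
          low_comm (k := k) (by omega) (supp_Lam (by omega) (by omega))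
        rw [Lam_succ_mul (a := a) (by omega) (by omega),
          Lam_succ_mul (a := a) (by omega) (by omega), Gen.shift_eq_self _ (by omega),
          hab.braid, ← hbL, ← hab.braid]
      · obtain rfl : k = 2 := by omega
        obtain ⟨i, rfl⟩ := Gen.exists_eq_t (a := a) (by omega)
        -- Starting from `t_{i+2}` makes the twofold predecessor equal to the given `t_i`.
        have := circle_shift (a := .t (i + 2)) (b := b) (.inl hb.symm) z
        rw [Lam_two_mul (a := .t (i + 2)) rfl, Lam_two_mul (a := .t (i + 1)) rfl]
        have e1 : (i + 2 - 1 : ZMod e) = i + 1 := by ring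
        simpa [Gen.pred, Gen.shift, e1] using this

theorem Lam_mul_low {k : ℕ} (hk : 1 ≤ k) (hkr : k + 1 ≤ r) {x : BraidMonoid e r}
    (hx : supp k x = 1) (z : BraidMonoid e r) :
    Lam e r (k + 1) * (x * z) = shift 1 x * (Lam e r (k + 1) * z) := by
  induction x using induction_left generalizing z with
  | one => simp
  | gen_mul a x ih =>
    rw [supp_mul_eq_one, supp_gen_eq_one] at hx
    rw [mul_assoc, Lam_mul_gen (by omega) hkr (by omega), ih hx.2, map_mul, shift_gen, mul_assoc]

theorem shift_Lam (c : ZMod e) {k : ℕ} (hk : 2 ≤ k) (hkr : k ≤ r) :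
    shift c (Lam e r k) = Lam e r k := by
  induction k, hk using Nat.le_induction with
  | base =>
    rw [← mul_one (Lam e r 2)]
    nth_rw 1 [Lam_two_mul (a := .t 0) rfl]
    rw [Lam_two_mul (a := .t c) rfl]
    simp [Gen.pred, Gen.shift, sub_eq_add_neg, add_comm]
  | succ k hk ih =>
    obtain ⟨a, ha⟩ := Gen.exists_pos_eq (e := e) (r := r) (j := k + 1) (by omega) hkr
    rw [← mul_one (Lam e r (k + 1)), Lam_succ_mul hk ha]
    simp [ih (by omega), Gen.shift_eq_self c (a := a) (by omega)]

/-- The least common multiple of `s_{k+1}` and `Λ_k` is `Λ_k Λ_{k+1}`. -/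
theorem Lam_dvd_of_gen_dvd (he : 2 ≤ e) {k : ℕ} (hk : 2 ≤ k) {a : Gen e r} (ha : a.pos = k + 1)
    {u : BraidMonoid e r} (h : gen a ∣ Lam e r k * u) : Lam e r (k + 1) ∣ u := by
  induction k, hk using Nat.le_induction generalizing a u with
  | base =>
    have hadj : ∀ i, Adj a (.t i) := fun i => .inr ha.symm
    rw [Lam_two_mul (a := .t 1) rfl] at h
    obtain ⟨v, hv⟩ := dvd_of_adj he (hadj _) h
    rw [mul_assoc] at hv
    obtain ⟨w, rfl, hw⟩ := (fit_of_gen_mul_eq he hv).exists_adj (hadj (1 - 1)).symm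
    -- Since `t_1 ≠ t_0`, the equation `t_1 v = t_0 a w` forces `t_{-1} ∣ a w`. The resulting `t_0
    -- t_{-1}` is the copy of `τ` in the middle of `Λ_3`.
    have hne := Gen.pred_ne_self he (a := (Gen.t 1 : Gen e r)) (b := .t 0)
      (by have : Fact (1 < e) := ⟨he⟩; simp) rfl
    have hd := dvd_of_circle he hne rfl ⟨v, hw.symm⟩
    obtain ⟨y, rfl⟩ := dvd_of_adj he (hadj _).symm hd
    refine ⟨y, ?_⟩
    rw [Lam_succ_mul le_rfl ha, Lam_two_mul (a := .t (1 - 1)) rfl, mul_assoc]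
    rfl
  | succ k hk ih =>
    have hr : a.pos ≤ r := by
      cases a with
      | t i => simp [Gen.pos] at ha; omega
      | s j hj => exact hj.2
    obtain ⟨b, hb⟩ := Gen.exists_pos_eq (e := e) (r := r) (j := k + 1) (by omega) (by omega)
    have hab : Adj a b := .inr (by omega)
    have hL := supp_Lam (e := e) hk (by omega : k ≤ r)
    have hcomm := fun z => low_comm (a := a) (by omega) hL z
    rw [Lam_succ_mul hk hb] at h
    have h1 := dvd_of_adj he hab h
    obtain ⟨v, hv⟩ := gen_dvd_of_dvd_low_mul he (by omega) hL ((dvd_mul_right _ _).trans h1)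
    rw [hv, ← hcomm] at h1
    have h2 := dvd_of_mul_dvd_mul_left he _ h1
    -- The induction hypothesis is applied to `v`, where `b * u = a * v`. The steps below transfer
    -- the result back to `u`.
    obtain ⟨x, rfl⟩ := ih hb h2
    obtain ⟨y, rfl, hy⟩ := (fit_of_gen_mul_eq he hv).exists_adj hab.symm
    rw [Lam_succ_mul hk hb] at hy
    have h3 := left_cancel he _ hy
    obtain ⟨z, hz⟩ := gen_dvd_of_dvd_low_mul he (by omega) hL ⟨y, h3⟩
    rw [hz, ← hcomm] at h3
    obtain rfl := left_cancel he _ h3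
    obtain ⟨w, rfl, rfl⟩ := (fit_of_gen_mul_eq he hz).exists_adj hab.symm
    refine ⟨w, ?_⟩
    rw [Lam_succ_mul (by omega) ha, Lam_succ_mul hk hb]

/-- The least common multiple of `Λ_k` and a generator `b` of lower position is `Λ_k` times the
generator to which `Λ_k` conjugates `b`. -/
theorem gen_dvd_of_dvd_Lam_mul (he : 2 ≤ e) {k : ℕ} (hk : 2 ≤ k) (hkr : k ≤ r) {a : Gen e r}
    (ha : a.pos < k) {u : BraidMonoid e r} (h : gen (a.shift 1) ∣ Lam e r k * u) :
    gen a ∣ u := by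
  have ha2 := a.two_le_pos
  induction k, hk using Nat.le_induction generalizing u with
  | base => omega
  | succ k hk ih =>
    obtain ⟨b, hb⟩ := Gen.exists_pos_eq (e := e) (r := r) (j := k + 1) (by omega) hkr
    rw [Lam_succ_mul hk hb] at h
    rcases Nat.lt_or_ge a.pos k with hlt | hge
    · have hab : Far a b := .inl (by omega)
      have hab' : Far (a.shift 1) b := by simpa [Far] using hab
      exact dvd_of_far he hab (ih (by omega) hlt (dvd_of_far he hab' h))
    · rcases Nat.lt_or_ge 2 k with h2 | h2
      · obtain ⟨k, rfl⟩ : ∃ l, k = l + 1 := ⟨k - 1, by omega⟩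
        have hab : Adj a b := .inl (by omega)
        rw [Gen.shift_eq_self _ (by omega)] at h
        have h1 := dvd_of_adj he hab h
        rw [Lam_succ_mul (a := a) (by omega) (by omega)] at h1
        have h3 := dvd_of_mul_dvd_mul_left he _ h1
        have h4 := gen_dvd_of_dvd_low_mul he (k := k) (by omega)
          (supp_Lam (by omega) (by omega)) h3
        have h5 := dvd_of_adj he hab.symm h4
        exact dvd_of_mul_dvd_mul_left he _ h5
      · obtain rfl : k = 2 := by omega
        obtain ⟨i, rfl⟩ := Gen.exists_eq_t (a := a) (by omega)
        have hab : ∀ j, Adj (.t j) b := fun j => .inl hb.symm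
        have h1 := dvd_of_adj he (hab _) h
        rw [Lam_two_mul (a := .t (i + 1)) rfl] at h1
        have h3 := dvd_of_mul_dvd_mul_left he _ h1
        have h5 := dvd_of_adj he (hab _).symm h3
        simpa [Gen.pred] using dvd_of_mul_dvd_mul_left he _ h5

/-! ### The elements `s_{m+1} ⋯ s_k` -/

/-- The element `s_{m+1} s_{m+2} ⋯ s_k`. -/
def tail (e r m k : ℕ) : BraidMonoid e r := ((List.range' (m + 1) (k - m)).map (s e r)).prod

@[simp] theorem tail_self (k : ℕ) : tail e r k k = 1 := by simp [tail]

theorem tail_mul {m k : ℕ} (hmk : m < k) {a : Gen e r} (h3 : 3 ≤ a.pos) (ha : a.pos = m + 1)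
    (z : BraidMonoid e r) : tail e r m k * z = gen a * (tail e r (m + 1) k * z) := by
  obtain ⟨l, rfl⟩ := Nat.exists_eq_add_of_lt hmk
  have h1 : m + l + 1 - m = l + 1 := by omega
  have h2 : m + l + 1 - (m + 1) = l := by omega
  rw [tail, tail, h1, h2, List.range'_succ, List.map_cons, List.prod_cons, mul_assoc, ← ha,
    s_pos h3]

section Tail

variable {m k : ℕ}

theorem low_dvd_of_dvd_tail_mul (he : 2 ≤ e) (hm : 2 ≤ m) (hmk : m ≤ k) (hk : k ≤ r)
    {x u : BraidMonoid e r} (hx : supp (m - 1) x = 1) (h : x ∣ tail e r m k * u) : x ∣ u := by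
  induction hmk using Nat.decreasingInduction with
  | self => simpa using h
  | of_succ m hmk ih =>
    obtain ⟨a, ha⟩ := Gen.exists_pos_eq (e := e) (r := r) (j := m + 1) (by omega) (by omega)
    rw [tail_mul hmk (by omega) ha] at h
    exact ih (by omega) (supp_mono (by omega) hx)
      (low_dvd_of_dvd_gen_mul he (by omega) hx h)

theorem tail_mul_low (hm : 2 ≤ m) (hmk : m ≤ k) (hk : k ≤ r) {x : BraidMonoid e r}
    (hx : supp (m - 1) x = 1) (z : BraidMonoid e r) :
    tail e r m k * (x * z) = x * (tail e r m k * z) := by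
  induction hmk using Nat.decreasingInduction with
  | self => simp
  | of_succ m hmk ih =>
    obtain ⟨a, ha⟩ := Gen.exists_pos_eq (e := e) (r := r) (j := m + 1) (by omega) (by omega)
    rw [tail_mul hmk (by omega) ha, ih (by omega) (supp_mono (by omega) hx),
      low_comm (by omega) hx, tail_mul hmk (by omega) ha]

/-- Each braid relation replaces divisibility by a letter at `m` with divisibility of a shorter tail
by the letter at `m + 1`, splitting `a` off `u`. At the end a letter at position `k` would divide an
element supported below `k`. -/
theorem not_gen_dvd_tail_mul (he : 2 ≤ e) (hmk : m ≤ k) (hk : k ≤ r) {a : Gen e r}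
    (ha : a.pos = m) {u : BraidMonoid e r} (hu : supp (k - 1) u = 1) :
    ¬ gen a ∣ tail e r m k * u := by
  have ha2 := a.two_le_pos
  intro h
  induction hmk using Nat.decreasingInduction generalizing a u with
  | self =>
    rw [tail_self, one_mul] at h
    have := pos_le_of_dvd h hu
    omega
  | of_succ m hmk ih =>
    obtain ⟨b, hb⟩ := Gen.exists_pos_eq (e := e) (r := r) (j := m + 1) (by omega) (by omega)
    rw [tail_mul hmk (by omega) hb] at h
    have h1 := dvd_of_adj he (.inl (by omega)) h
    have hsa : supp (m + 1 - 1) (gen a) = 1 := supp_gen_eq_one.2 (by omega)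
    obtain ⟨v, rfl⟩ := low_dvd_of_dvd_tail_mul he (by omega) hmk hk hsa
      ((dvd_mul_right _ _).trans h1)
    rw [tail_mul_low (by omega) hmk hk hsa] at h1
    exact ih hb (supp_mul_eq_one.1 hu).2 (by omega) (dvd_of_mul_dvd_mul_left he _ h1)

theorem gen_mul_tail (hm : 2 ≤ m) (hk : k ≤ r) {a b : Gen e r} (hma : m + 1 < a.pos)
    (hak : a.pos ≤ k) (hb : b.pos + 1 = a.pos) (z : BraidMonoid e r) :
    gen a * (tail e r m k * z) = tail e r m k * (gen b * z) := by
  -- The descending induction starts where the tail begins with `b` followed by `a`.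
  have hmb : m ≤ b.pos - 1 := by omega
  induction hmb using Nat.decreasingInduction with
  | self =>
    have hba : Adj b a := .inl hb
    have h0 : ∀ z, tail e r (b.pos - 1) k * z =
        gen b * (gen a * (tail e r (b.pos - 1 + 1 + 1) k * z)) := fun z => by
      rw [tail_mul (by omega) (a := b) (by omega) (by omega),
        tail_mul (by omega) (a := a) (by omega) (by omega)]
    rw [h0, h0, ← hba.braid,
      tail_mul_low (by omega) (by omega) hk (supp_gen_eq_one.2 (by omega))]
  | of_succ m hmb ih =>
    obtain ⟨c, hc⟩ := Gen.exists_pos_eq (e := e) (r := r) (j := m + 1) (by omega) (by omega)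
    have hac : Far a c := .inr (by omega)
    rw [tail_mul (by omega) (by omega) hc, hac.comm, ih (by omega) (by omega),
      tail_mul (by omega) (by omega) hc]

theorem gen_dvd_of_dvd_tail_mul (he : 2 ≤ e) (hm : 2 ≤ m) (hk : k ≤ r) {a b : Gen e r}
    (hma : m + 1 < a.pos) (hak : a.pos ≤ k) (hb : b.pos + 1 = a.pos) {u : BraidMonoid e r}
    (h : gen a ∣ tail e r m k * u) : gen b ∣ u := by
  have hmb : m ≤ b.pos - 1 := by omega
  induction hmb using Nat.decreasingInduction with
  | self =>
    rw [tail_mul (by omega) (a := b) (by omega) (by omega)] at h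
    have h1 := dvd_of_adj he (.inr hb) h
    rw [tail_mul (by omega) (a := a) (by omega) (by omega)] at h1
    exact low_dvd_of_dvd_tail_mul he (by omega) (by omega) hk (supp_gen_eq_one.2 (by omega))
      (dvd_of_mul_dvd_mul_left he _ h1)
  | of_succ m hmb ih =>
    obtain ⟨c, hc⟩ := Gen.exists_pos_eq (e := e) (r := r) (j := m + 1) (by omega) (by omega)
    rw [tail_mul (by omega) (by omega) hc] at h
    exact ih (by omega) (by omega) (dvd_of_far he (.inr (by omega)) h)

end Tail

/-! ### Right divisors of `Λ_k` -/

/-- The right divisors of `Λ_k`. -/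
inductive IsLamSuffix (k : ℕ) : BraidMonoid e r → Prop
  | of_tail (m : ℕ) (hm : 2 ≤ m) (hmk : m ≤ k) : IsLamSuffix k (tail e r m k)
  | of_t (a : Gen e r) (ha : a.pos = 2) : IsLamSuffix k (gen a * tail e r 2 k)
  | of_lam (m : ℕ) (hm : 2 ≤ m) (hmk : m ≤ k) :
      IsLamSuffix k (Lam e r m * tail e r m k)

/-- If a generator `a` divides `q * u`, with `q` a right divisor of `Λ_k` and `u` in the parabolic
submonoid below `k`, then `a` divides `q` or moves through `q` to a generator that divides `u`. -/
theorem IsLamSuffix.gen_dvd_mul (he : 2 ≤ e) {k : ℕ} (hk2 : 2 ≤ k) (hk : k ≤ r)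
    {q u : BraidMonoid e r} (hq : IsLamSuffix k q) (hu : supp (k - 1) u = 1) {a : Gen e r}
    (hak : a.pos ≤ k) (h : gen a ∣ q * u) :
    (∃ q', IsLamSuffix k q' ∧ q = gen a * q') ∨ ∃ b, gen a * q = q * gen b ∧ gen b ∣ u := by
  have ha2 := a.two_le_pos
  cases hq with
  | of_tail m hm hmk =>
    -- Below `m` the letter commutes with the tail, at `m` it cannot divide, at `m + 1` it is the
    -- first letter of the tail, and above that it crosses with its position lowered by one.
    rcases lt_trichotomy a.pos m with ham | ham | ham
    · have hsa : supp (m - 1) (gen a) = 1 := supp_gen_eq_one.2 (by omega)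
      refine .inr ⟨a, ?_, low_dvd_of_dvd_tail_mul he hm hmk hk hsa h⟩
      simpa using (tail_mul_low hm hmk hk hsa 1).symm
    · exact absurd h (not_gen_dvd_tail_mul he hmk hk ham hu)
    · rcases Nat.lt_or_ge (m + 1) a.pos with ham' | ham'
      · obtain ⟨b, hb⟩ := Gen.exists_pos_eq (e := e) (r := r) (j := a.pos - 1)
          (by omega) (by omega)
        refine .inr ⟨b, ?_, gen_dvd_of_dvd_tail_mul he hm hk ham' hak (by omega) h⟩
        simpa using gen_mul_tail hm hk ham' hak (by omega : b.pos + 1 = a.pos) 1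
      · refine .inl ⟨_, .of_tail (m + 1) (by omega) (by omega), ?_⟩
        simpa using tail_mul (by omega) (by omega) (by omega : a.pos = m + 1) (1 : BraidMonoid e r)
  | of_t c hc =>
    rw [mul_assoc] at h
    rcases Nat.lt_or_ge 3 a.pos with ha | ha
    · obtain ⟨b, hb⟩ := Gen.exists_pos_eq (e := e) (r := r) (j := a.pos - 1) (by omega) (by omega)
      have hac : Far a c := .inr (by omega)
      refine .inr ⟨b, ?_, gen_dvd_of_dvd_tail_mul he le_rfl hk ha hak (by omega)
        (dvd_of_far he hac h)⟩
      have := gen_mul_tail le_rfl hk ha hak (by omega : b.pos + 1 = a.pos) 1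
      rw [mul_one, mul_one] at this
      rw [hac.comm, this, mul_assoc]
    · rcases Nat.lt_or_ge 2 a.pos with ha' | ha'
      -- Here `a` is `s_3`: from `a c a = c a c`, where the last `c` commutes with `s_4 ⋯ s_k`, the
      -- letter `a` emerges on the right as `c`.
      · have hac : Adj a c := .inr (by omega)
        have hsc : supp (3 - 1) (gen c) = 1 := supp_gen_eq_one.2 (by omega)
        have h1 := dvd_of_adj he hac h
        rw [tail_mul (by omega) (a := a) (by omega) (by omega)] at h1
        refine .inr ⟨c, ?_, low_dvd_of_dvd_tail_mul he (by omega) (by omega) hk hsc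
          (dvd_of_mul_dvd_mul_left he _ h1)⟩
        have h2 := tail_mul_low (by omega) (by omega : 3 ≤ k) hk hsc 1
        rw [mul_one, mul_one] at h2
        rw [mul_assoc, tail_mul (by omega) (a := a) (by omega) (by omega), h2,
          ← mul_one (tail e r 2 k), tail_mul (by omega) (a := a) (by omega) (by omega), mul_one,
          hac.braid]
      · by_cases hac : a = c
        · subst hac
          exact .inl ⟨_, .of_tail 2 le_rfl hk2, rfl⟩
        · exact absurd (dvd_of_circle he hac (by omega) h)
            (not_gen_dvd_tail_mul he hk2 hk (by simpa using hc) hu)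
  | of_lam m hm hmk =>
    rw [mul_assoc] at h
    have hL := supp_Lam (e := e) hm (by omega : m ≤ r)
    rcases lt_trichotomy a.pos m with ham | ham | ham
    · have hs : (a.shift (-1)).shift 1 = a := by simp
      have hsb : supp (m - 1) (gen (a.shift (-1))) = 1 :=
        supp_gen_eq_one.2 (by rw [Gen.pos_shift]; omega)
      rw [← hs] at h
      refine .inr ⟨a.shift (-1), ?_, low_dvd_of_dvd_tail_mul he hm hmk hk hsb
        (gen_dvd_of_dvd_Lam_mul he hm (by omega) (by simpa using ham) h)⟩
      have h2 := tail_mul_low hm hmk hk hsb 1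
      have h3 := Lam_mul_gen (a := a.shift (-1)) hm (by omega) (by simpa using ham) (tail e r m k)
      rw [mul_one, mul_one] at h2
      rw [mul_assoc, h2, h3, hs]
    · refine .inl ?_
      rcases Nat.lt_or_ge 2 m with hm' | hm'
      · obtain ⟨m, rfl⟩ : ∃ l, m = l + 1 := ⟨m - 1, by omega⟩
        refine ⟨_, .of_lam m (by omega) (by omega), ?_⟩
        rw [Lam_succ_mul (by omega) ham, ← mul_one (tail e r (m + 1) k),
          ← tail_mul (by omega) (by omega) ham, mul_one]
      · obtain rfl : m = 2 := by omega
        exact ⟨_, .of_t a.pred (by simpa using ham), Lam_two_mul ham _⟩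
    · rcases Nat.lt_or_ge (m + 1) a.pos with ham' | ham'
      · obtain ⟨b, hb⟩ := Gen.exists_pos_eq (e := e) (r := r) (j := a.pos - 1)
          (by omega) (by omega)
        refine .inr ⟨b, ?_, gen_dvd_of_dvd_tail_mul he hm hk ham' hak (by omega)
          (gen_dvd_of_dvd_low_mul he ham' hL h)⟩
        have := gen_mul_tail hm hk ham' hak (by omega : b.pos + 1 = a.pos) 1
        rw [mul_one, mul_one] at this
        rw [low_comm ham' hL, this, mul_assoc]
      -- This case is impossible: `Λ_{m+1}` would divide `tail e r m k * u`. Cancelling `a` and then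
      -- `Λ_m` leaves `a` dividing `tail e r (m + 1) k * w`, with `w` supported below `k`.
      · have ham'' : a.pos = m + 1 := by omega
        obtain ⟨v, hv⟩ := Lam_dvd_of_gen_dvd he hm ham'' h
        rw [Lam_succ_mul hm ham'', tail_mul (by omega) (by omega) ham''] at hv
        have h1 := left_cancel he _ hv
        have hL' : supp (m + 1 - 1) (Lam e r m) = 1 := hL
        obtain ⟨w, rfl⟩ := low_dvd_of_dvd_tail_mul he (by omega) (by omega) hk hL'
          ⟨_, h1⟩
        rw [tail_mul_low (by omega) (by omega) hk hL'] at h1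
        exact absurd ⟨v, left_cancel he _ h1⟩
          (not_gen_dvd_tail_mul he (by omega) hk ham'' (supp_mul_eq_one.1 hu).2)

/-! ### Divisors of `Δ` -/

theorem eq_one_of_len_eq_zero {x : BraidMonoid e r} (h : len x = 0) : x = 1 := by
  induction x using induction_left with
  | one => rfl
  | gen_mul a x _ => simp at h

/-- The product `p_2 p_3 ⋯ p_{n+1}`. -/
def partialProd (p : ℕ → BraidMonoid e r) (n : ℕ) : BraidMonoid e r :=
  ((List.range' 2 n).map p).prod

theorem partialProd_zero (p : ℕ → BraidMonoid e r) : partialProd p 0 = 1 := rfl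

theorem partialProd_succ (p : ℕ → BraidMonoid e r) (n : ℕ) :
    partialProd p (n + 1) = partialProd p n * p (n + 2) := by
  simp [partialProd, List.range'_concat, add_comm]

theorem partialProd_congr {p q : ℕ → BraidMonoid e r} {n : ℕ}
    (h : ∀ k, 2 ≤ k → k ≤ n + 1 → p k = q k) : partialProd p n = partialProd q n := by
  induction n with
  | zero => rfl
  | succ n ih =>
    rw [partialProd_succ, partialProd_succ, ih fun k h2 hk => h k h2 (by omega),
      h _ (by omega) (by omega)]

theorem supp_partialProd_Lam {n : ℕ} (hn : n + 1 ≤ r) :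
    supp (n + 1) (partialProd (Lam e r) n) = 1 := by
  induction n with
  | zero => simp [partialProd_zero]
  | succ n ih =>
    rw [partialProd_succ, supp_mul_eq_one]
    exact ⟨supp_mono (by omega) (ih (by omega)), supp_Lam (by omega) (by omega)⟩

theorem mul_Lam_eq {n : ℕ} (hn : n + 2 ≤ r) {x : BraidMonoid e r} (hx : supp (n + 1) x = 1) :
    x * Lam e r (n + 2) = Lam e r (n + 2) * shift (-1) x := by
  have h := Lam_mul_low (by omega) (by omega : n + 1 + 1 ≤ r) (supp_shift _ (-1) x hx) 1
  rw [shift_neg_shift, mul_one, mul_one] at h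
  exact h.symm

theorem partialProd_dvd {n : ℕ} (hn : n + 1 ≤ r) {p : ℕ → BraidMonoid e r}
    (hp : ∀ k, 2 ≤ k → k ≤ n + 1 → p k ∣ Lam e r k) :
    partialProd p n ∣ partialProd (Lam e r) n := by
  induction n with
  | zero => exact dvd_refl _
  | succ n ih =>
    obtain ⟨Q, hQ⟩ := ih (by omega) fun k h2 hk => hp k h2 (by omega)
    obtain ⟨q, hq⟩ := hp (n + 2) (by omega) le_rfl
    have hs := supp_partialProd_Lam (e := e) (by omega : n + 1 ≤ r)
    rw [hQ, supp_mul_eq_one] at hs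
    refine ⟨q * shift (-1) Q, ?_⟩
    rw [partialProd_succ, partialProd_succ, hQ, mul_assoc, mul_Lam_eq (by omega) hs.2, hq]
    simp only [mul_assoc]

/-- The cofactor `q` is kept among the listed suffixes so that the induction on `x`, one letter at a
time on the right, can continue. -/
theorem exists_suffix_of_dvd (he : 2 ≤ e) {n : ℕ} (hn : n + 2 ≤ r) {x : BraidMonoid e r}
    (hx : x ∣ partialProd (Lam e r) (n + 1)) :
    ∃ P p q, x = P * p ∧ P ∣ partialProd (Lam e r) n ∧ Lam e r (n + 2) = p * q ∧
      IsLamSuffix (n + 2) q := by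
  induction x using induction_right with
  | one =>
    refine ⟨1, 1, Lam e r (n + 2), by simp, one_dvd _, by simp, ?_⟩
    simpa using IsLamSuffix.of_lam (e := e) (r := r) (n + 2) (by omega) le_rfl
  | mul_gen x a ih =>
    obtain ⟨P, p, q, rfl, ⟨Q, hQ⟩, hq, hsuf⟩ := ih ((dvd_mul_right _ _).trans hx)
    have hs := supp_partialProd_Lam (e := e) (by omega : n + 1 ≤ r)
    have hs' := supp_partialProd_Lam (e := e) (by omega : n + 1 + 1 ≤ r)
    have hap : a.pos ≤ n + 2 := by
      obtain ⟨w, hw⟩ := hx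
      rw [hw, supp_mul_eq_one, supp_mul_eq_one, supp_gen_eq_one] at hs'
      exact hs'.1.2
    rw [hQ, supp_mul_eq_one] at hs
    have hd : gen a ∣ q * shift (-1) Q := by
      rw [partialProd_succ, hQ, mul_assoc P Q, mul_Lam_eq hn hs.2, hq, mul_assoc p q,
        ← mul_assoc P p (q * _)] at hx
      exact dvd_of_mul_dvd_mul_left he _ hx
    have hsQ := supp_shift (n + 1) (-1) Q hs.2
    rcases hsuf.gen_dvd_mul he (by omega) hn hsQ hap hd with ⟨q', hq', rfl⟩ | ⟨b, hb, hbQ⟩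
    · exact ⟨P, p * gen a, q', mul_assoc _ _ _, ⟨Q, hQ⟩, by rw [hq, mul_assoc], hq'⟩
    · have hbp := pos_le_of_dvd hbQ hsQ
      refine ⟨P * gen (b.shift 1), p, q, ?_, ?_, hq, hsuf⟩
      -- From `p a q = p q b = Λ b = (b.shift 1) Λ = (b.shift 1) p q`, cancelling `q` moves the new
      -- letter to the left of `p`.
      · have h1 := Lam_mul_gen (by omega) hn (by omega : b.pos < n + 2) 1
        rw [mul_one, mul_one, hq, mul_assoc, ← hb, ← mul_assoc, ← mul_assoc] at h1
        rw [mul_assoc, mul_assoc, right_cancel he _ h1]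
      · obtain ⟨z, hz⟩ := hbQ
        rw [hQ, ← shift_neg_shift 1 Q, hz, map_mul, shift_gen]
        exact ⟨shift 1 z, by rw [mul_assoc]⟩

theorem exists_partialProd_of_dvd (he : 2 ≤ e) {n : ℕ} (hn : n + 1 ≤ r) {x : BraidMonoid e r}
    (hx : x ∣ partialProd (Lam e r) n) :
    ∃ p : ℕ → BraidMonoid e r, (∀ k, 2 ≤ k → k ≤ n + 1 → p k ∣ Lam e r k) ∧
      x = partialProd p n := by
  induction n generalizing x with
  | zero =>
    rw [partialProd_zero] at hx
    refine ⟨1, fun k h2 hk => by omega, ?_⟩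
    obtain ⟨y, hy⟩ := hx
    have hl := congrArg len hy
    rw [len_one, len_mul] at hl
    exact eq_one_of_len_eq_zero (by omega)
  | succ n ih =>
    obtain ⟨P, p, q, rfl, hP, hq, -⟩ := exists_suffix_of_dvd he hn hx
    obtain ⟨f, hf, rfl⟩ := ih (by omega) hP
    refine ⟨Function.update f (n + 2) p, fun k h2 hk => ?_, ?_⟩
    · by_cases hkn : k = n + 2
      · subst hkn
        rw [Function.update_self]
        exact ⟨q, hq⟩
      · rw [Function.update_of_ne hkn]
        exact hf k h2 (by omega)
    · rw [partialProd_succ, Function.update_self]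
      congr 1
      refine partialProd_congr fun k h2 hk => ?_
      rw [Function.update_of_ne (by omega)]

/-! ### `Δ` is the minimal Garside element -/

theorem Delta_eq : Delta e r = partialProd (Lam e r) (r - 1) := rfl

theorem gen_dvd_Delta (hr : 2 ≤ r) (a : Gen e r) : gen a ∣ Delta e r := by
  have ha2 := a.two_le_pos
  have har := a.pos_le hr
  have haL : gen a ∣ Lam e r a.pos := by
    rcases Nat.lt_or_ge 2 a.pos with h | h
    · obtain ⟨k, hk⟩ : ∃ l, a.pos = l + 1 := ⟨a.pos - 1, by omega⟩
      rw [hk, ← mul_one (Lam e r (k + 1)), Lam_succ_mul (by omega) hk]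
      exact dvd_mul_right _ _
    · have h2 : a.pos = 2 := by omega
      rw [h2, ← mul_one (Lam e r 2), Lam_two_mul h2]
      exact dvd_mul_right _ _
  -- The generator is written as an ordered product with the single nontrivial factor `p_k = a` at
  -- `k = a.pos`, so `partialProd_dvd` applies.
  have hprod : ∀ n, a.pos ≤ n + 1 →
      partialProd (Function.update 1 a.pos (gen a)) n = gen a := by
    intro n hn
    induction n with
    | zero => omega
    | succ n ih =>
      rw [partialProd_succ]
      by_cases h : a.pos ≤ n + 1
      · rw [ih h, Function.update_of_ne (by omega), Pi.one_apply, mul_one]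
      · have h1 : ∀ m, partialProd (1 : ℕ → BraidMonoid e r) m = 1 := by
          intro m
          induction m with
          | zero => rfl
          | succ m ih => rw [partialProd_succ, ih, Pi.one_apply, one_mul]
        rw [show n + 2 = a.pos by omega, Function.update_self,
          partialProd_congr (q := 1), h1, one_mul]
        intro k h2 hk
        rw [Function.update_of_ne (by omega)]
  rw [Delta_eq, ← hprod (r - 1) (by omega)]
  refine partialProd_dvd (by omega) fun k h2 hk => ?_
  by_cases hka : k = a.pos
  · subst hka; simpa using haL
  · rw [Function.update_of_ne hka]; exact one_dvd _

/-- `Δ_k = Λ_2 ⋯ Λ_k` commutes with the generators of position at most `k`, up to a shift. -/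
theorem partialProd_Lam_mul_gen {n : ℕ} (hn : n + 2 ≤ r) {a : Gen e r} (ha : a.pos ≤ n + 2) :
    partialProd (Lam e r) (n + 1) * gen a =
      gen (a.shift ((n : ZMod e) + 2)) * partialProd (Lam e r) (n + 1) := by
  induction n generalizing a with
  | zero =>
    have ha2 := a.two_le_pos
    obtain ⟨i, rfl⟩ := Gen.exists_eq_t (a := a) (by omega)
    -- Both `τ t_i` and `t_{i+2} τ` equal `t_{i+2} t_{i+1} t_i`, so `τ` shifts by two; each later
    -- `Λ_k` adds one.
    have h1 := Lam_two_mul (r := r) (a := .t (i + 2)) rfl (gen (.t i))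
    have h2 := Lam_two_mul (r := r) (a := .t (i + 1)) rfl 1
    have e1 : (i + 2 - 1 : ZMod e) = i + 1 := by ring
    simp only [Gen.pred, e1, add_sub_cancel_right, mul_one] at h1 h2
    simp only [partialProd_succ, partialProd_zero, one_mul, zero_add, Gen.shift, Nat.cast_zero,
      zero_add]
    rw [h1, h2]
  | succ n ih =>
    rw [partialProd_succ]
    rcases Nat.lt_or_ge a.pos (n + 3) with h | h
    · have hL := Lam_mul_gen (by omega) hn h 1
      rw [mul_one, mul_one] at hL
      rw [mul_assoc, hL, ← mul_assoc, ih (by omega) (by simp; omega), mul_assoc,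
        Gen.shift_shift]
      congr 3
      push_cast
      ring
    -- The top letter commutes with the factors up to `Λ_{n+1}`, and also with `Λ_{n+2} Λ_{n+3}`,
    -- because these two commute and `Λ_{n+3} = a Λ_{n+2} a`.
    · have hap : a.pos = n + 2 + 1 := by omega
      rw [Gen.shift_eq_self _ (by omega), partialProd_succ]
      have hs := supp_partialProd_Lam (e := e) (by omega : n + 1 ≤ r)
      have hc := low_comm (a := a) (by omega) hs
        (Lam e r (n + 2) * Lam e r (n + 3))
      have hLL : Lam e r (n + 2) * Lam e r (n + 3) = Lam e r (n + 3) * Lam e r (n + 2) := by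
        have := mul_Lam_eq (n := n + 1) hn (supp_Lam (e := e) (k := n + 2) (by omega) (by omega))
        rwa [shift_Lam _ (by omega) (by omega)] at this
      have h1 := Lam_succ_mul (by omega) hap 1
      have h2 := Lam_succ_mul (by omega) hap (Lam e r (n + 2))
      rw [mul_one] at h1
      have h4 : Lam e r (n + 2) * Lam e r (n + 3) * gen a =
          gen a * (Lam e r (n + 2) * Lam e r (n + 3)) := by
        calc _ = Lam e r (n + 3) * Lam e r (n + 2) * gen a := by rw [hLL]
          _ = gen a * (Lam e r (n + 2) * (gen a * Lam e r (n + 2))) * gen a := by rw [h2]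
          _ = _ := by rw [h1]; simp only [mul_assoc, mul_one]
      rw [mul_assoc (partialProd _ n), hc, mul_assoc, h4]

theorem Delta_mul (hr : 2 ≤ r) (x : BraidMonoid e r) :
    Delta e r * x = shift r x * Delta e r := by
  induction x using induction_left with
  | one => simp
  | gen_mul a x ih =>
    obtain ⟨n, rfl⟩ := Nat.exists_eq_add_of_le' hr
    have := partialProd_Lam_mul_gen (e := e) le_rfl (a.pos_le hr)
    have hD : Delta e (n + 2) = partialProd (Lam e (n + 2)) (n + 1) := Delta_eq
    rw [← hD] at this
    rw [← mul_assoc, this, mul_assoc, ih, map_mul, shift_gen, mul_assoc]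
    push_cast
    rfl

theorem dvd_Delta_iff (he : 2 ≤ e) (hr : 2 ≤ r) (x : BraidMonoid e r) :
    x ∣ Delta e r ↔ ∃ z, Delta e r = z * x := by
  constructor
  · rintro ⟨y, hy⟩
    refine ⟨shift r y, right_cancel he y ?_⟩
    rw [Delta_mul hr, mul_assoc, ← hy]
  · rintro ⟨z, hz⟩
    refine ⟨shift (-(r : ZMod e)) z, left_cancel he z ?_⟩
    have := Delta_mul hr (shift (-(r : ZMod e)) z)
    rw [shift_neg_shift] at this
    rw [← this, ← mul_assoc, ← hz]

theorem finite_gen (he : 2 ≤ e) : Finite (Gen e r) := by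
  have : NeZero e := ⟨by omega⟩
  let f : Gen e r → ZMod e ⊕ Fin (r + 1) := fun a => match a with
    | .t i => .inl i
    | .s j h => .inr ⟨j, by omega⟩
  refine Finite.of_injective f ?_
  rintro (i | ⟨i, hi⟩) (j | ⟨j, hj⟩) h <;> simp_all [f]

/-- Length is additive, so divisors of `d` are represented by words of length at most `len d` in a
finite alphabet. -/
theorem finite_dvd (he : 2 ≤ e) (d : BraidMonoid e r) : {x : BraidMonoid e r | x ∣ d}.Finite := by
  have := finite_gen (r := r) he
  refine ((List.finite_length_le (Gen e r) (len d)).image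
    fun l => PresentedMonoid.mk (Rel e r) (FreeMonoid.ofList l)).subset ?_
  rintro x ⟨y, rfl⟩
  obtain ⟨l, rfl⟩ := PresentedMonoid.surjective_mk x
  refine ⟨FreeMonoid.toList l, ?_, rfl⟩
  have := len_mk l
  have h2 : (FreeMonoid.toList l).length = l.length := rfl
  simp only [Set.mem_ofPred_eq, len_mul]
  omega

theorem isGarsideElement_Delta (he : 2 ≤ e) (hr : 2 ≤ r) : IsGarsideElement (Delta e r) := by
  refine ⟨dvd_Delta_iff he hr, finite_dvd he _, ?_⟩
  rw [eq_top_iff, ← PresentedMonoid.closure_range_of (Rel e r)]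
  refine Submonoid.closure_mono ?_
  rintro _ ⟨a, rfl⟩
  exact gen_dvd_Delta hr a

/-- An element of length one that is a product of divisors of `d` must be one of the factors. -/
theorem gen_dvd_of_isGarsideElement {d : BraidMonoid e r} (hd : IsGarsideElement d)
    (a : Gen e r) : gen a ∣ d := by
  have key : ∀ x : BraidMonoid e r, x ∈ Submonoid.closure {x | x ∣ d} → len x = 1 → x ∣ d := by
    intro x hx
    induction hx using Submonoid.closure_induction with
    | mem x hx => exact fun _ => hx
    | one => simp
    | mul x y _ _ hx hy =>
      intro h
      rw [len_mul] at h
      rcases Nat.eq_zero_or_pos (len x) with h0 | h0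
      · rw [eq_one_of_len_eq_zero h0, one_mul]
        exact hy (by omega)
      · rw [eq_one_of_len_eq_zero (x := y) (by omega), mul_one]
        exact hx (by omega)
  exact key _ (by rw [hd.2.2]; trivial) (len_gen a)

theorem partialProd_Lam_dvd (he : 2 ≤ e) {d : BraidMonoid e r} (hd : ∀ a : Gen e r, gen a ∣ d)
    {n : ℕ} (hn : n + 2 ≤ r) : partialProd (Lam e r) (n + 1) ∣ d := by
  induction n with
  | zero =>
    obtain ⟨u, rfl⟩ := hd (.t 1)
    have : Fact (1 < e) := ⟨he⟩
    obtain ⟨v, rfl⟩ := dvd_of_circle he (a := .t 0) (b := .t 1) (by simp) rfl (hd (.t 0))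
    rw [← Lam_two_mul rfl, partialProd_succ, partialProd_zero, one_mul]
    exact dvd_mul_right _ _
  | succ n ih =>
    obtain ⟨u, rfl⟩ := ih (by omega)
    obtain ⟨a, ha⟩ := Gen.exists_pos_eq (e := e) (r := r) (j := n + 3) (by omega) hn
    have h := hd a
    rw [partialProd_succ, mul_assoc] at h
    -- The letter `s_{n+3}` passes all factors before `Λ_{n+2}`, and the least common multiple with
    -- `Λ_{n+2}` then supplies `Λ_{n+3}`.
    have h1 := gen_dvd_of_dvd_low_mul he (by omega) (supp_partialProd_Lam (by omega)) h
    rw [partialProd_succ _ (n + 1)]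
    exact mul_dvd_mul_left _ (Lam_dvd_of_gen_dvd he (by omega) ha h1)

theorem isMinimalGarsideElement_Delta (he : 2 ≤ e) (hr : 2 ≤ r) :
    IsMinimalGarsideElement (Delta e r) := by
  refine ⟨isGarsideElement_Delta he hr, fun d hd => ?_⟩
  obtain ⟨n, rfl⟩ := Nat.exists_eq_add_of_le' hr
  exact partialProd_Lam_dvd he (gen_dvd_of_isGarsideElement hd) le_rfl

theorem isSimpleElement_iff_dvd_Delta (he : 2 ≤ e) (hr : 2 ≤ r) {x : BraidMonoid e r} :
    IsSimpleElement x ↔ x ∣ Delta e r :=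
  ⟨fun ⟨_, hd, hx⟩ => hx.trans (hd.2 _ (isGarsideElement_Delta he hr)),
    fun h => ⟨_, isMinimalGarsideElement_Delta he hr, h⟩⟩

end BraidMonoid

theorem theorem3p7 (e r : ℕ) (he : 2 ≤ e) (hr : 2 ≤ r) :
    IsMinimalGarsideElement (BraidMonoid.Delta e r) ∧
    ∀ x : BraidMonoid e r, IsSimpleElement x ↔
      ∃ p : ℕ → BraidMonoid e r,
        (∀ k : ℕ, 2 ≤ k → k ≤ r → p k ∣ BraidMonoid.Lam e r k) ∧
        x = BraidMonoid.orderedProd r p := by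
  refine ⟨BraidMonoid.isMinimalGarsideElement_Delta he hr, fun x => ?_⟩
  obtain ⟨n, rfl⟩ := Nat.exists_eq_add_of_le' hr
  rw [BraidMonoid.isSimpleElement_iff_dvd_Delta he hr]
  constructor
  · exact fun h => BraidMonoid.exists_partialProd_of_dvd he (n := n + 1) le_rfl h
  · rintro ⟨p, hp, rfl⟩
    exact BraidMonoid.partialProd_dvd (n := n + 1) le_rfl hp
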